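/- Let $\mathbb{F}_2$ be the field with two elements and let $K$ be the field of Hahn series $\sum_{q\in\mathbb{R}}a_qt^q$ with coefficients $a_q\in\mathbb{F}_2$, exponents in $\mathbb{R}$ and well-ordered support, with valuation $\nu(a)=\min(\operatorname{supp}(a))$ for $a\neq0$ and $\nu(0)=\infty$. Let $A=\{a\in K:\nu(a)\geq0\}$ be the Hahn ring, let $I_{>0}=\{a\in K:\nu(a)>0\}$ be its maximal ideal, and define the $A$-modules $\Theta=K/I_{>0}$ and $\mathbb{F}=A/I_{>0}$. For an $A$-module $M$ put $DM=\operatorname{Hom}_A(M,\Theta)$, and call $M$ *$\Theta$-reflexive* if the evaluation map $\chi_M:M\to D^2M$, $\chi_M(m)(\alpha)=\alpha(m)$, is an isomorphism. **Theorem.** If $M$ is a $\Theta$-reflexive $A$-module, then $\operatorname{Tor}_1^A(\mathbb{F},M)$ is finite. -/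

import Mathlib

noncomputable section

open CategoryTheory TensorProduct

universe u

/-- The field `K` of Hahn series with value group `ℝ` and residue field of order two. -/
abbrev HahnField : Type := HahnSeries ℝ (ZMod 2)

/-- The Hahn ring `A = {a ∈ K : ν(a) ≥ 0}`; the valuation `ν` is `HahnSeries.orderTop`. -/
def hahnRing : Subring HahnField where
  carrier := {a | 0 ≤ a.orderTop}
  mul_mem' {a b} ha hb := by
    simp only [Set.mem_ofPred_eq, HahnSeries.orderTop_mul] at *
    exact add_nonneg ha hb
  one_mem' := by simp
  add_mem' {a b} ha hb := by
    simp only [Set.mem_ofPred_eq] at *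
    exact (le_min ha hb).trans HahnSeries.min_orderTop_le_orderTop_add
  zero_mem' := by simp
  neg_mem' {a} ha := by simpa using ha

/-- The `A`-submodule `I_{>0} = {a ∈ K : ν(a) > 0}` of `K`. -/
def hahnPos : Submodule hahnRing HahnField where
  carrier := {a | 0 < a.orderTop}
  add_mem' {a b} ha hb := by
    simp only [Set.mem_ofPred_eq] at *
    exact (lt_min ha hb).trans_le HahnSeries.min_orderTop_le_orderTop_add
  zero_mem' := by simp
  smul_mem' c a ha := by
    have hc : 0 ≤ (c : HahnField).orderTop := by simpa [hahnRing] using c.2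
    simp only [Set.mem_ofPred_eq, Subring.smul_def, smul_eq_mul, HahnSeries.orderTop_mul] at *
    calc 0 < a.orderTop := ha
      _ = 0 + a.orderTop := (zero_add _).symm
      _ ≤ _ := by gcongr

/-- `I_{>0}` as an ideal of `A`. -/
def hahnPosIdeal : Ideal hahnRing :=
  hahnPos.comap (Algebra.linearMap hahnRing HahnField)

/-- The `A`-module `Θ = K / I_{>0}`. -/
abbrev HahnTheta : Type := HahnField ⧸ hahnPos

/-- The `A`-module `𝔽 = A / I_{>0}`. -/
abbrev HahnResidue : Type := hahnRing ⧸ hahnPosIdeal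

/-- The evaluation map `χ_M : M → D²M`, `χ_M(m)(α) = α(m)`, where `D = Hom_A(-, Θ)`. -/
def thetaEval (M : Type u) [AddCommGroup M] [Module hahnRing M] :
    M →ₗ[hahnRing] ((M →ₗ[hahnRing] HahnTheta) →ₗ[hahnRing] HahnTheta) :=
  LinearMap.flip LinearMap.id

/-- `M` is `Θ`-reflexive if `χ_M` is an isomorphism. -/
def IsThetaReflexive (M : Type u) [AddCommGroup M] [Module hahnRing M] : Prop :=
  Function.Bijective (thetaEval M)

/-- The functor `N ⊗_A -` on `A`-modules. The module `N` lives in the universe of `A`, the argument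
in an arbitrary one. -/
def hahnTensor (N : Type) [AddCommGroup N] [Module hahnRing N] :
    ModuleCat.{u} hahnRing ⥤ ModuleCat.{u} hahnRing where
  obj X := ModuleCat.of hahnRing (N ⊗[hahnRing] X)
  map f := ModuleCat.ofHom (f.hom.lTensor N)
  map_id X := by ext : 1; exact LinearMap.lTensor_id N X
  map_comp f g := by ext : 1; exact LinearMap.lTensor_comp N g.hom f.hom

instance hahnTensor_additive (N : Type) [AddCommGroup N] [Module hahnRing N] :
    (hahnTensor.{u} N).Additive where
  map_add {X Y f g} := by ext : 1; exact LinearMap.lTensor_add N f.hom g.hom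

/-- `Tor_n^A(N, M)`, the `n`-th left derived functor of `N ⊗_A -` evaluated at `M`. -/
def hahnTor (n : ℕ) (N : Type) [AddCommGroup N] [Module hahnRing N]
    (M : Type u) [AddCommGroup M] [Module hahnRing M] : ModuleCat.{u} hahnRing :=
  ((hahnTensor.{u} N).leftDerived n).obj (ModuleCat.of hahnRing M)

/-- For modules in the universe of `A`, this is Mathlib's `Tor`. -/
theorem hahnTor_eq_Tor (n : ℕ) (N M : Type) [AddCommGroup N] [Module hahnRing N]
    [AddCommGroup M] [Module hahnRing M] :
    hahnTor n N M = ((Tor (ModuleCat.{0} hahnRing) n).obj (ModuleCat.of hahnRing N)).obj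
      (ModuleCat.of hahnRing M) :=
  rfl

end

noncomputable section

open CategoryTheory TensorProduct

universe u

/-! `Θ` is an injective cogenerator, since `K` is maximally complete. Hence a reflexive `M` contains
no infinite family whose linear relations all have coefficients in `I_{>0}`: functionals could be
prescribed on such a family as any 0-1 pattern of `thetaOne`, and a functional of the pattern that
ignores finitely many indices is evaluation at no element of `M`. If `Tor₁` were infinite, it would
have an infinite `𝔽₂`-basis, represented by `z i` in `P₁` with `d₁ (z i) = t^(ε i) • y i`. The
elements `p (y i)` form a family of the forbidden kind: a relation with a unit coefficient,
multiplied by a suitable power of `t`, yields a nonempty vanishing sum of basis vectors. -/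

/-! ### Valuation, divisibility and powers of `t` -/

theorem mem_hahnRing {a : HahnField} : a ∈ hahnRing ↔ 0 ≤ a.orderTop := Iff.rfl

theorem mem_hahnPos {a : HahnField} : a ∈ hahnPos ↔ 0 < a.orderTop := Iff.rfl

theorem mem_hahnPosIdeal {a : hahnRing} :
    a ∈ hahnPosIdeal ↔ 0 < (a : HahnField).orderTop := Iff.rfl

theorem mem_hahnPos_iff_coeff {a : HahnField} : a ∈ hahnPos ↔ ∀ r ≤ 0, a.coeff r = 0 := by
  rw [mem_hahnPos]
  constructor
  · intro h r hr
    exact HahnSeries.coeff_eq_zero_of_lt_orderTop (lt_of_le_of_lt (by exact_mod_cast hr) h)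
  · intro h
    by_contra hn
    rw [not_lt] at hn
    have ha : a ≠ 0 := by rintro rfl; simp at hn
    have hq := HahnSeries.order_eq_orderTop_of_ne_zero ha
    rw [← hq] at hn
    exact HahnSeries.coeff_orderTop_ne hq.symm (h _ (by exact_mod_cast hn))

/-- Divisibility in the Hahn ring is governed by the valuation. -/
theorem hahnRing_dvd {a b : hahnRing}
    (h : (a : HahnField).orderTop ≤ (b : HahnField).orderTop) : a ∣ b := by
  by_cases ha : (a : HahnField) = 0
  · have hb : (b : HahnField) = 0 := by
      rw [ha] at h; simpa using h
    have : b = 0 := Subtype.ext hb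
    simp [this]
  · have hc : (b : HahnField) / a * a = b := div_mul_cancel₀ _ ha
    have ho := congrArg HahnSeries.orderTop hc
    rw [HahnSeries.orderTop_mul] at ho
    have hca : 0 ≤ ((b : HahnField) / a).orderTop := by
      rw [← ho] at h
      have : (0 : WithTop ℝ) + (a : HahnField).orderTop
          ≤ ((b : HahnField) / a).orderTop + (a : HahnField).orderTop := by simpa using h
      exact (WithTop.add_le_add_iff_right (HahnSeries.orderTop_ne_top.2 ha)).1 this
    exact ⟨⟨_, hca⟩, Subtype.ext (by rw [mul_comm]; exact hc.symm)⟩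

/-- An element of the Hahn ring of valuation zero is congruent to `1` modulo `I_{>0}`. -/
theorem sub_one_mem_hahnPosIdeal {a : hahnRing} (h : (a : HahnField).orderTop = 0) :
    a - 1 ∈ hahnPosIdeal := by
  have h0 : (a : HahnField).coeff 0 = 1 := by
    have := HahnSeries.coeff_orderTop_ne (x := (a : HahnField)) (g := 0) (by exact_mod_cast h)
    revert this
    generalize (a : HahnField).coeff 0 = c
    revert c; decide
  change ((a - 1 : hahnRing) : HahnField) ∈ hahnPos
  rw [mem_hahnPos_iff_coeff]
  intro r hr
  rw [AddSubgroupClass.coe_sub, HahnSeries.coeff_sub, Subring.coe_one]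
  rcases hr.eq_or_lt with rfl | hr
  · simp [h0]
  · rw [HahnSeries.coeff_eq_zero_of_lt_orderTop (x := (a : HahnField)) (by rw [h]; exact_mod_cast hr),
      HahnSeries.coeff_one, if_neg hr.ne, sub_zero]

theorem hahnPosIdeal_of_proper {J : Ideal hahnRing} (hJ : J ≠ ⊤) : J ≤ hahnPosIdeal := by
  intro a ha
  rw [mem_hahnPosIdeal]
  by_contra hn
  rw [not_lt] at hn
  have h1 : a ∣ 1 := hahnRing_dvd (by simpa using hn)
  exact hJ ((Ideal.eq_top_iff_one J).2 (Ideal.mem_of_dvd J h1 ha))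

/-- The element `t ^ q` of the Hahn ring for `q ≥ 0`. -/
def hahnT (q : ℝ) (hq : 0 ≤ q) : hahnRing :=
  ⟨HahnSeries.single q 1, by
    rw [mem_hahnRing, HahnSeries.orderTop_single one_ne_zero]; exact_mod_cast hq⟩

@[simp] theorem coe_hahnT (q : ℝ) (hq : 0 ≤ q) :
    (hahnT q hq : HahnField) = HahnSeries.single q 1 := rfl

theorem orderTop_hahnT (q : ℝ) (hq : 0 ≤ q) : (hahnT q hq : HahnField).orderTop = q :=
  HahnSeries.orderTop_single one_ne_zero

theorem hahnT_mul {p q : ℝ} (hp : 0 ≤ p) (hq : 0 ≤ q) :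
    hahnT p hp * hahnT q hq = hahnT (p + q) (add_nonneg hp hq) := by
  ext1; simp

/-! ### `Θ` is an injective cogenerator -/

/-- The coefficient of `t ^ 0`, as a function on `Θ`. -/
def thetaCoeff : HahnTheta →+ ZMod 2 :=
  QuotientAddGroup.lift hahnPos.toAddSubgroup
    { toFun := fun a : HahnField => a.coeff 0
      map_zero' := rfl
      map_add' := fun _ _ => rfl }
    fun _ ha => mem_hahnPos_iff_coeff.1 ha 0 le_rfl

theorem thetaCoeff_mk (a : HahnField) : thetaCoeff (hahnPos.mkQ a) = a.coeff 0 := rfl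

theorem thetaCoeff_hahnT_smul (a : HahnField) (q : ℝ) (hq : 0 ≤ q) :
    thetaCoeff (hahnT q hq • hahnPos.mkQ a) = a.coeff (-q) := by
  rw [← map_smul, thetaCoeff_mk, Subring.smul_def, smul_eq_mul, coe_hahnT]
  have := HahnSeries.coeff_single_mul_add (r := (1 : ZMod 2)) (x := a) (a := -q) (b := q)
  simpa using this

theorem hahnTheta_baer : Module.Baer hahnRing HahnTheta := by
  intro J f
  classical
  -- If `f` is multiplication by `b`, the coefficient of `b` at `r` must be the `t^0` coefficient of
  -- `f (t^(-r))`. Where `t^(-r)` is not in `J`, it is unconstrained and set to 0.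
  let c : ℝ → ZMod 2 := fun r =>
    if h : ∃ hr : 0 ≤ -r, hahnT (-r) hr ∈ J then thetaCoeff (f ⟨_, h.2⟩) else 0
  have key : ∀ (s : ℝ) (hs : 0 ≤ s) (hJ : hahnT s hs ∈ J) (a : HahnField),
      hahnPos.mkQ a = f ⟨_, hJ⟩ → ∀ r ≤ 0, c (r - s) = a.coeff r := by
    intro s hs hJ a ha r hr
    have hrs : hahnT (-(r - s)) (by linarith) = hahnT (-r) (by linarith) * hahnT s hs := by
      rw [hahnT_mul]; congr 1; ring
    have hmem : hahnT (-(r - s)) (by linarith) ∈ J := hrs ▸ J.mul_mem_left _ hJ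
    have : c (r - s) = thetaCoeff (f ⟨_, hmem⟩) := dif_pos ⟨by linarith, hmem⟩
    have hf : f ⟨_, hmem⟩ = hahnT (-r) (by linarith) • hahnPos.mkQ a := by
      rw [ha, ← map_smul]; congr 1; exact Subtype.ext hrs
    rw [this, hf, thetaCoeff_hahnT_smul, neg_neg]
  -- Below `g 0`, `c` is a shift of a single Hahn series, so its support has no infinite descent
  -- there.
  have hpwo : (Function.support c).IsPWO := by
    rw [Set.isPWO_iff_isWF, Set.isWF_iff_no_descending_seq]
    intro g hg hmem
    have h0 : ∃ hr : 0 ≤ -(g 0), hahnT (-(g 0)) hr ∈ J := by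
      by_contra hn; exact hmem 0 (dif_neg hn)
    obtain ⟨hr, hJ⟩ := h0
    obtain ⟨a, ha⟩ := hahnPos.mkQ_surjective (f ⟨_, hJ⟩)
    refine Set.isWF_iff_no_descending_seq.1 a.isWF_support (fun n => g n - g 0)
      (fun m n hmn => by have := hg hmn; simp only; linarith) fun n => ?_
    have hle : g n ≤ g 0 := hg.antitone (Nat.zero_le n)
    have := key _ hr hJ a ha (g n - g 0) (by linarith)
    rw [HahnSeries.mem_support, ← this, show g n - g 0 - -(g 0) = g n by ring]
    exact hmem n
  let b : HahnField := ⟨c, hpwo⟩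
  refine ⟨hahnPos.mkQ ∘ₗ LinearMap.toSpanSingleton hahnRing HahnField b, fun x hx => ?_⟩
  by_cases hx0 : x = 0
  · subst hx0
    rw [map_zero, show (⟨0, hx⟩ : J) = 0 from rfl, map_zero]
  have hx0' : (x : HahnField) ≠ 0 := fun h => hx0 (Subtype.ext h)
  have ho := HahnSeries.order_eq_orderTop_of_ne_zero hx0'
  have hs : 0 ≤ (x : HahnField).order := HahnSeries.zero_le_orderTop_iff.1 x.2
  obtain ⟨u, hu⟩ : hahnT _ hs ∣ x := hahnRing_dvd (by rw [orderTop_hahnT, ho])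
  have hJ : hahnT _ hs ∈ J :=
    J.mem_of_dvd (hahnRing_dvd (by rw [orderTop_hahnT, ho])) hx
  have hf : f ⟨x, hx⟩ = u • f ⟨_, hJ⟩ := by
    rw [← map_smul]; congr 1; exact Subtype.ext (hu.trans (mul_comm _ _))
  obtain ⟨a, ha⟩ := hahnPos.mkQ_surjective (f ⟨_, hJ⟩)
  conv_lhs => rw [hu]
  rw [mul_comm, ← smul_eq_mul, map_smul, hf]
  congr 1
  rw [← ha]
  simp only [LinearMap.comp_apply, LinearMap.toSpanSingleton_apply]
  rw [← sub_eq_zero, ← map_sub, Submodule.mkQ_apply, Submodule.Quotient.mk_eq_zero,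
    mem_hahnPos_iff_coeff]
  intro r hr
  rw [HahnSeries.coeff_sub, Subring.smul_def, smul_eq_mul, coe_hahnT, sub_eq_zero,
    ← key _ hs hJ a ha r hr]
  have := HahnSeries.coeff_single_mul_add (r := (1 : ZMod 2)) (x := b)
    (a := r - (x : HahnField).order) (b := (x : HahnField).order)
  simpa using this

/-- A functional on `X` vanishing on the kernel of `g : X → Y` factors through `g`. -/
theorem exists_comp_eq_of_ker_le {X Y : Type*} [AddCommGroup X] [AddCommGroup Y]
    [Module hahnRing X] [Module hahnRing Y] (g : X →ₗ[hahnRing] Y) (h : X →ₗ[hahnRing] HahnTheta)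
    (hker : LinearMap.ker g ≤ LinearMap.ker h) : ∃ β : Y →ₗ[hahnRing] HahnTheta, β ∘ₗ g = h := by
  obtain ⟨β, hβ⟩ := hahnTheta_baer.extension_property ((LinearMap.ker g).liftQ g le_rfl)
    (LinearMap.ker_eq_bot.1 (Submodule.ker_liftQ_eq_bot' _ g rfl)) ((LinearMap.ker g).liftQ h hker)
  refine ⟨β, LinearMap.ext fun x => ?_⟩
  simpa using LinearMap.congr_fun hβ (Submodule.Quotient.mk x)

/-- The class of `1` in `Θ`. -/
def thetaOne : HahnTheta := hahnPos.mkQ 1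

theorem smul_thetaOne_eq_zero {a : hahnRing} : a • thetaOne = 0 ↔ a ∈ hahnPosIdeal := by
  rw [thetaOne, ← map_smul, Submodule.mkQ_apply, Submodule.Quotient.mk_eq_zero, Subring.smul_def,
    smul_eq_mul, mul_one]
  rfl

theorem thetaOne_ne_zero : thetaOne ≠ 0 := by
  intro h
  have := (smul_thetaOne_eq_zero (a := 1)).1 (by rw [h, smul_zero])
  rw [mem_hahnPosIdeal] at this
  simp at this

/-- `Θ` is a cogenerator. -/
theorem exists_eq_thetaOne {X : Type*} [AddCommGroup X] [Module hahnRing X] {x : X} (hx : x ≠ 0) :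
    ∃ β : X →ₗ[hahnRing] HahnTheta, β x = thetaOne := by
  obtain ⟨β, hβ⟩ := exists_comp_eq_of_ker_le (LinearMap.toSpanSingleton hahnRing X x)
    (LinearMap.toSpanSingleton hahnRing HahnTheta thetaOne) fun a ha => by
      rw [LinearMap.mem_ker, LinearMap.toSpanSingleton_apply, smul_thetaOne_eq_zero]
      refine hahnPosIdeal_of_proper (J := LinearMap.ker (LinearMap.toSpanSingleton hahnRing X x))
        (fun h => hx ?_) ha
      have h1 : (1 : hahnRing) ∈ LinearMap.ker (LinearMap.toSpanSingleton hahnRing X x) := by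
        rw [h]; trivial
      simpa using h1
  exact ⟨β, by simpa using LinearMap.congr_fun hβ 1⟩

/-! ### Obstruction to reflexivity -/

/-- A reflexive module contains no infinite family all of whose linear relations have
coefficients in the maximal ideal. -/
theorem not_isThetaReflexive_of_infinite {ι M : Type*} [AddCommGroup M] [Module hahnRing M]
    [Infinite ι] (m : ι → M)
    (hm : ∀ a : ι →₀ hahnRing, Finsupp.linearCombination hahnRing m a = 0 →
      ∀ i, a i ∈ hahnPosIdeal) : ¬ IsThetaReflexive M := by
  classical
  intro hM
  -- Coefficients in `I_{>0}` kill `thetaOne`, so every 0-1 pattern respects the relations.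
  have hval (S : Set ι) :
      ∃ β : M →ₗ[hahnRing] HahnTheta, ∀ i, β (m i) = if i ∈ S then thetaOne else 0 := by
    obtain ⟨β, hβ⟩ := exists_comp_eq_of_ker_le (Finsupp.linearCombination hahnRing m)
      (Finsupp.linearCombination hahnRing fun i => if i ∈ S then thetaOne else 0) fun a ha => by
        rw [LinearMap.mem_ker, Finsupp.linearCombination_apply]
        refine Finset.sum_eq_zero fun i _ => ?_
        beta_reduce
        rw [smul_ite, smul_zero, smul_thetaOne_eq_zero.2 (hm a ha i), ite_self]
    exact ⟨β, fun i => by simpa using LinearMap.congr_fun hβ (Finsupp.single i 1)⟩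
  let Q := (ι → HahnTheta) ⧸ LinearMap.range (Finsupp.lcoeFun (R := hahnRing) (α := ι)
    (M := HahnTheta))
  let mk : (ι → HahnTheta) →ₗ[hahnRing] Q := Submodule.mkQ _
  have hmk (v : ι → HahnTheta) : mk v = 0 ↔ (Function.support v).Finite := by
    rw [Submodule.mkQ_apply, Submodule.Quotient.mk_eq_zero]
    constructor
    · rintro ⟨w, rfl⟩
      exact w.hasFiniteSupport
    · intro h
      exact ⟨Finsupp.ofSupportFinite v h, rfl⟩
  obtain ⟨φ, hφ⟩ := exists_eq_thetaOne (x := mk fun _ => thetaOne) (by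
    rw [Ne, hmk, Function.support_const thetaOne_ne_zero]
    exact Set.infinite_univ)
  let R : (M →ₗ[hahnRing] HahnTheta) →ₗ[hahnRing] (ι → HahnTheta) :=
    LinearMap.pi fun i => LinearMap.applyₗ (m i)
  obtain ⟨x, hx⟩ := hM.2 (φ ∘ₗ mk ∘ₗ R)
  have hx' (β : M →ₗ[hahnRing] HahnTheta) : β x = φ (mk fun i => β (m i)) :=
    LinearMap.congr_fun hx β
  by_cases hxN : x ∈ LinearMap.range (Finsupp.linearCombination hahnRing m)
  · obtain ⟨a, rfl⟩ := hxN
    obtain ⟨β, hβ⟩ := hval ((a.support : Set ι)ᶜ)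
    have h1 : β (Finsupp.linearCombination hahnRing m a) = 0 := by
      rw [Finsupp.linearCombination_apply, Finsupp.sum, map_sum]
      refine Finset.sum_eq_zero fun i hi => ?_
      rw [map_smul, hβ, if_neg (by simpa using hi), smul_zero]
    have h2 : mk (fun i => β (m i)) = mk fun _ => thetaOne := by
      rw [← sub_eq_zero, ← map_sub, hmk]
      refine a.support.finite_toSet.subset fun i hi => ?_
      by_contra hn
      refine hi ?_
      simp only [Pi.sub_apply, hβ]
      rw [if_pos (Set.mem_compl hn), sub_self]
    rw [hx', h2, hφ] at h1
    exact thetaOne_ne_zero h1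
  -- Off the span, some functional kills every `m i` but not `x`, whereas evaluation at `x` depends
  -- only on the values at the `m i`.
  · let N := LinearMap.range (Finsupp.linearCombination hahnRing m)
    obtain ⟨γ, hγ⟩ := exists_eq_thetaOne (x := N.mkQ x)
      (by rwa [Ne, Submodule.mkQ_apply, Submodule.Quotient.mk_eq_zero])
    have h0 (i : ι) : (γ ∘ₗ N.mkQ) (m i) = 0 := by
      have : N.mkQ (m i) = 0 := by
        rw [Submodule.mkQ_apply, Submodule.Quotient.mk_eq_zero]
        exact ⟨Finsupp.single i 1, by simp⟩
      rw [LinearMap.comp_apply, this, map_zero]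
    have h3 := hx' (γ ∘ₗ N.mkQ)
    rw [LinearMap.comp_apply, hγ] at h3
    simp only [h0] at h3
    rw [show (fun _ : ι => (0 : HahnTheta)) = 0 from rfl, map_zero, map_zero] at h3
    exact thetaOne_ne_zero h3

/-! ### From relations to classes in `Tor₁` -/

/-- Torsion elements `m i`, killed by `t ^ ε i`, satisfy only relations with coefficients in the
maximal ideal as soon as the classes they define in `Tor₁(𝔽, M)` are linearly independent. -/
theorem mem_hahnPosIdeal_of_linearCombination_eq_zero {ι M : Type*} [AddCommGroup M]
    [Module hahnRing M] (m : ι → M) (ε : ι → ℝ) (hε : ∀ i, 0 < ε i)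
    (hm : ∀ i, hahnT (ε i) (hε i).le • m i = 0)
    (hind : ∀ (S : Finset ι) (η : ℝ) (hη : 0 < η) (a b : ι → hahnRing), S.Nonempty →
      (∀ i ∈ S, b i - 1 ∈ hahnPosIdeal) →
      (∀ i ∈ S, hahnT η hη.le * a i = hahnT (ε i) (hε i).le * b i) → ∑ i ∈ S, a i • m i ≠ 0)
    (a : ι →₀ hahnRing) (ha : Finsupp.linearCombination hahnRing m a = 0) (j : ι) :
    a j ∈ hahnPosIdeal := by
  classical
  by_contra hj
  have hj0 : a j ≠ 0 := by rintro h; exact hj (h ▸ zero_mem _)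
  -- For `r ≥ 0`, `t^r` makes `a i` divisible by `t^(ε i)`, hence kills `a i • m i`, once `r ≥ e i`.
  let e : ι → ℝ := fun i => ε i - (a i : HahnField).order
  have hord (i : ι) (hi : i ∈ a.support) :
      (((a i : HahnField).order : ℝ) : WithTop ℝ) = (a i : HahnField).orderTop :=
    HahnSeries.order_eq_orderTop_of_ne_zero fun h => Finsupp.mem_support_iff.1 hi (Subtype.ext h)
  have hjs : j ∈ a.support := Finsupp.mem_support_iff.2 hj0
  have hej : 0 < e j := by
    rw [mem_hahnPosIdeal, not_lt, ← hord j hjs] at hj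
    have : (a j : HahnField).order ≤ 0 := by exact_mod_cast hj
    have := hε j
    simp only [e]; linarith
  obtain ⟨k, hk, hmax⟩ := a.support.exists_max_image e ⟨j, hjs⟩
  have hγ : 0 < e k := hej.trans_le (hmax j hjs)
  -- Multiplying by `t^s` kills exactly the terms below the maximal `e k` and leaves `η = e k - s >
  -- 0`.
  obtain ⟨s, hs0, hsk, hs⟩ : ∃ s, 0 ≤ s ∧ s < e k ∧ ∀ i ∈ a.support, e i ≠ e k → e i ≤ s := by
    let T := insert 0 ((a.support.filter fun i => e i ≠ e k).image e)
    have hT : T.Nonempty := Finset.insert_nonempty _ _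
    refine ⟨T.max' hT, T.le_max' _ (Finset.mem_insert_self _ _), ?_, fun i hi hne =>
      T.le_max' _ (Finset.mem_insert_of_mem (Finset.mem_image_of_mem _
        (Finset.mem_filter.2 ⟨hi, hne⟩)))⟩
    rw [Finset.max'_lt_iff]
    intro y hy
    rcases Finset.mem_insert.1 hy with rfl | hy
    · exact hγ
    · obtain ⟨i, hi, rfl⟩ := Finset.mem_image.1 hy
      rw [Finset.mem_filter] at hi
      exact lt_of_le_of_ne (hmax i hi.1) hi.2
  have hη : 0 < e k - s := sub_pos.2 hsk
  let S := a.support.filter fun i => e i = e k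
  have hb (i : ι) : ∃ b : hahnRing, i ∈ S → b - 1 ∈ hahnPosIdeal ∧
      hahnT (e k - s) hη.le * (hahnT s hs0 * a i) = hahnT (ε i) (hε i).le * b := by
    by_cases hi : i ∈ S
    · have hi' := Finset.mem_filter.1 hi
      have ho : ((hahnT (e k - s) hη.le * (hahnT s hs0 * a i) : hahnRing) : HahnField).orderTop
          = ε i := by
        rw [Subring.coe_mul, Subring.coe_mul, HahnSeries.orderTop_mul, HahnSeries.orderTop_mul,
          orderTop_hahnT, orderTop_hahnT, ← hord i hi'.1, ← WithTop.coe_add, ← WithTop.coe_add,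
          ← hi'.2]
        congr 1
        simp only [e]; ring
      obtain ⟨b, hb⟩ : hahnT (ε i) (hε i).le ∣ hahnT (e k - s) hη.le * (hahnT s hs0 * a i) :=
        hahnRing_dvd (by rw [ho, orderTop_hahnT])
      refine ⟨b, fun _ => ⟨sub_one_mem_hahnPosIdeal ?_, hb⟩⟩
      rw [hb, Subring.coe_mul, HahnSeries.orderTop_mul, orderTop_hahnT] at ho
      exact WithTop.add_left_cancel (WithTop.coe_ne_top (a := ε i)) (by rw [ho, add_zero])
    · exact ⟨0, fun h => absurd h hi⟩
  choose b hb using hb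
  refine hind S (e k - s) hη (fun i => hahnT s hs0 * a i) b ⟨k, Finset.mem_filter.2 ⟨hk, rfl⟩⟩
    (fun i hi => (hb i hi).1) (fun i hi => (hb i hi).2) ?_
  have hsum : ∑ i ∈ a.support, (hahnT s hs0 * a i) • m i = 0 := by
    simp only [mul_smul]
    rw [← Finset.smul_sum]
    rw [Finsupp.linearCombination_apply, Finsupp.sum] at ha
    rw [ha, smul_zero]
  rw [← hsum]
  refine Finset.sum_subset (Finset.filter_subset _ _) fun i hi hiS => ?_
  have hne : e i ≠ e k := fun h => hiS (Finset.mem_filter.2 ⟨hi, h⟩)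
  obtain ⟨c, hc⟩ : hahnT (ε i) (hε i).le ∣ hahnT s hs0 * a i := hahnRing_dvd (by
    rw [orderTop_hahnT, Subring.coe_mul, HahnSeries.orderTop_mul, orderTop_hahnT, ← hord i hi,
      ← WithTop.coe_add, WithTop.coe_le_coe]
    have := hs i hi hne
    simp only [e] at this; linarith)
  rw [hc, mul_comm, mul_smul, hm, smul_zero]

/-- In a finite sum with coefficients in `I_{>0}`, the least exponent is positive and factors out.
-/
theorem exists_hahnT_smul_eq {P : Type*} [AddCommGroup P] [Module hahnRing P] {y : P}
    (hy : y ∈ hahnPosIdeal • (⊤ : Submodule hahnRing P)) :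
    ∃ (ε : ℝ) (hε : 0 < ε) (y' : P), hahnT ε hε.le • y' = y := by
  refine Submodule.smul_induction_on hy (fun a ha n _ => ?_) ?_
  · by_cases h0 : (a : HahnField) = 0
    · exact ⟨1, one_pos, 0, by rw [smul_zero, show a = 0 from Subtype.ext h0, zero_smul]⟩
    · have ho := HahnSeries.order_eq_orderTop_of_ne_zero h0
      have hpos : 0 < (a : HahnField).order := (HahnSeries.zero_lt_orderTop_iff h0).1 ha
      obtain ⟨c, hc⟩ : hahnT _ hpos.le ∣ a := hahnRing_dvd (by rw [orderTop_hahnT, ho])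
      refine ⟨_, hpos, c • n, ?_⟩
      rw [smul_smul, ← hc]
  · have hdiv {δ ε : ℝ} (hδ : 0 ≤ δ) (hle : δ ≤ ε) :
        hahnT ε (hδ.trans hle) = hahnT δ hδ * hahnT (ε - δ) (sub_nonneg.2 hle) := by
      rw [hahnT_mul]; congr 1; ring
    rintro _ _ ⟨ε, hε, y, rfl⟩ ⟨ε', hε', y', rfl⟩
    rcases le_total ε ε' with h | h
    · exact ⟨ε, hε, y + hahnT (ε' - ε) (sub_nonneg.2 h) • y', by
        rw [smul_add, smul_smul, ← hdiv hε.le h]⟩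
    · exact ⟨ε', hε', hahnT (ε - ε') (sub_nonneg.2 h) • y + y', by
        rw [smul_add, smul_smul, ← hdiv hε'.le h]⟩

/-- Let `P₂ → P₁ → P₀ → M` be exact, with `M` reflexive. Then the homology at `P₁` modulo
`I_{>0}` is finite. -/
theorem finite_of_isThetaReflexive {M P₀ P₁ P₂ H : Type*} [AddCommGroup M] [Module hahnRing M]
    [AddCommGroup P₀] [Module hahnRing P₀] [AddCommGroup P₁] [Module hahnRing P₁]
    [AddCommGroup P₂] [Module hahnRing P₂] [AddCommGroup H] [Module hahnRing H]
    (d₂ : P₂ →ₗ[hahnRing] P₁) (d₁ : P₁ →ₗ[hahnRing] P₀) (p : P₀ →ₗ[hahnRing] M)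
    (hd : Function.Exact d₂ d₁) (hp : Function.Exact d₁ p)
    (q : (hahnPosIdeal • (⊤ : Submodule hahnRing P₀)).comap d₁ →ₗ[hahnRing] H)
    (hq : Function.Surjective q)
    (hker : ∀ z : (hahnPosIdeal • (⊤ : Submodule hahnRing P₀)).comap d₁,
      (z : P₁) ∈ LinearMap.range d₂ ⊔ hahnPosIdeal • (⊤ : Submodule hahnRing P₁) → q z = 0)
    (hM : IsThetaReflexive M) : Finite H := by
  classical
  by_contra hfin
  -- As `2 = 0` in `A`, `H` is an `𝔽₂`-space, finite once its basis is.
  let _ : Module (ZMod 2) H := AddCommGroup.zmodModule fun x => by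
    have h2 : (2 : hahnRing) = 0 := Subtype.ext (by
      change (2 : HahnField) = 0
      rw [← one_add_one_eq_two, ← HahnSeries.single_zero_one, ← HahnSeries.single_add,
        show (1 + 1 : ZMod 2) = 0 by decide, map_zero])
    rw [← ofNat_smul_eq_nsmul hahnRing 2 x]
    exact (congrArg (· • x) h2).trans (zero_smul _ _)
  let B := Module.Basis.ofVectorSpace (ZMod 2) H
  have hι : Infinite (Module.Basis.ofVectorSpaceIndex (ZMod 2) H) := by
    rw [← not_finite_iff_infinite]
    intro hf
    have := Module.Finite.of_basis B
    exact hfin (Module.finite_of_finite (ZMod 2))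
  choose z hz using fun i => hq (B i)
  choose ε hε y hy using fun i => exists_hahnT_smul_eq (z i).2
  refine not_isThetaReflexive_of_infinite (fun i => p (y i))
    (mem_hahnPosIdeal_of_linearCombination_eq_zero _ ε hε (fun i => ?_) ?_) hM
  · rw [← map_smul, hy]
    exact hp.apply_apply_eq_zero _
  intro S η hη a b hS hb hab h0
  simp only [← map_smul] at h0
  rw [← map_sum] at h0
  obtain ⟨w, hw⟩ := (hp _).1 h0
  -- Multiplying the relation by `t^η` turns each `y i` back into `d₁ (z i)`, up to `b i ≡ 1`.
  have hker' : d₁ (∑ i ∈ S, b i • (z i : P₁) - hahnT η hη.le • w) = 0 := by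
    rw [map_sub, map_smul, hw, Finset.smul_sum, map_sum, sub_eq_zero]
    refine Finset.sum_congr rfl fun i hi => ?_
    rw [map_smul, ← hy, smul_smul, smul_smul, hab i hi, mul_comm]
  have hηI : hahnT η hη.le ∈ hahnPosIdeal := by
    rw [mem_hahnPosIdeal, orderTop_hahnT]; exact_mod_cast hη
  have hq0 : q (∑ i ∈ S, b i • z i) = 0 := by
    refine hker _ ?_
    have hsum : ((∑ i ∈ S, b i • z i : (hahnPosIdeal • (⊤ : Submodule hahnRing P₀)).comap d₁) : P₁)
        = (∑ i ∈ S, b i • (z i : P₁) - hahnT η hη.le • w) + hahnT η hη.le • w := by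
      rw [sub_add_cancel]; simp
    rw [hsum]
    exact Submodule.add_mem_sup ((hd _).1 hker') (Submodule.smul_mem_smul hηI trivial)
  have hq1 : q (∑ i ∈ S, b i • z i) = ∑ i ∈ S, B i := by
    rw [map_sum]
    refine Finset.sum_congr rfl fun i hi => ?_
    rw [← hz, ← sub_eq_zero, ← map_sub]
    refine hker _ (Submodule.mem_sup_right ?_)
    have : ((b i • z i - z i : (hahnPosIdeal • (⊤ : Submodule hahnRing P₀)).comap d₁) : P₁)
        = (b i - 1) • (z i : P₁) := by
      rw [sub_smul, one_smul]; rfl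
    rw [this]
    exact Submodule.smul_mem_smul (hb i hi) trivial
  rw [hq1] at hq0
  obtain ⟨i, hi⟩ := hS
  exact one_ne_zero (linearIndependent_iff'.1 B.linearIndependent S (fun _ => 1)
    (by simpa using hq0) i hi)

/-! ### Identification with the derived functor -/

theorem one_tmul_eq_zero_iff {P : Type*} [AddCommGroup P] [Module hahnRing P] (y : P) :
    (1 : HahnResidue) ⊗ₜ[hahnRing] y = 0 ↔ y ∈ hahnPosIdeal • (⊤ : Submodule hahnRing P) := by
  rw [← (TensorProduct.quotTensorEquivQuotSMul P hahnPosIdeal).map_eq_zero_iff,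
    TensorProduct.quotTensorEquivQuotSMul_mk_one_tmul, Submodule.Quotient.mk_eq_zero]

theorem exists_one_tmul_eq {P : Type*} [AddCommGroup P] [Module hahnRing P]
    (x : HahnResidue ⊗[hahnRing] P) : ∃ y : P, (1 : HahnResidue) ⊗ₜ[hahnRing] y = x := by
  obtain ⟨y, hy⟩ := Submodule.mkQ_surjective _
    (TensorProduct.quotTensorEquivQuotSMul P hahnPosIdeal x)
  refine ⟨y, (TensorProduct.quotTensorEquivQuotSMul P hahnPosIdeal).injective ?_⟩
  rw [TensorProduct.quotTensorEquivQuotSMul_mk_one_tmul, ← hy]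
  rfl

theorem finite_hahnTor_one (M : Type u) [AddCommGroup M] [Module hahnRing M]
    (hM : IsThetaReflexive M) : Finite (hahnTor 1 HahnResidue M) := by
  let P := projectiveResolution (ModuleCat.of hahnRing M)
  let C := ((hahnTensor.{u} HahnResidue).mapHomologicalComplex _).obj P.complex
  let S := C.sc' 2 1 0
  let e : hahnTor 1 HahnResidue M ≅ S.moduleCatLeftHomologyData.H :=
    P.isoLeftDerivedObj (hahnTensor.{u} HahnResidue) 1 ≪≫
      C.homologyIsoSc' 2 1 0 (by simp) (by simp) ≪≫ S.moduleCatHomologyIso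
  suffices Finite (LinearMap.ker S.g.hom ⧸ LinearMap.range S.moduleCatToCycles) from
    @Finite.of_equiv _ _ this e.toLinearEquiv.symm.toEquiv
  let d₁ := (P.complex.d 1 0).hom
  let d₂ := (P.complex.d 2 1).hom
  have hg (z : P.complex.X 1) : S.g.hom ((1 : HahnResidue) ⊗ₜ[hahnRing] z) =
      (1 : HahnResidue) ⊗ₜ[hahnRing] d₁ z := rfl
  have hf (z : P.complex.X 2) : S.f.hom ((1 : HahnResidue) ⊗ₜ[hahnRing] z) =
      (1 : HahnResidue) ⊗ₜ[hahnRing] d₂ z := rfl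
  let T : P.complex.X 1 →ₗ[hahnRing] HahnResidue ⊗[hahnRing] P.complex.X 1 :=
    TensorProduct.mk hahnRing _ _ 1
  let c : (hahnPosIdeal • (⊤ : Submodule hahnRing (P.complex.X 0))).comap d₁
      →ₗ[hahnRing] LinearMap.ker S.g.hom :=
    LinearMap.codRestrict _ (T ∘ₗ Submodule.subtype _) fun z =>
      (hg z).trans ((one_tmul_eq_zero_iff _).2 z.2)
  refine finite_of_isThetaReflexive d₂ d₁
    (((HomologicalComplex.singleObjXSelf (ComplexShape.down ℕ) 0
      (ModuleCat.of hahnRing M)).hom).hom ∘ₗ (P.π.f 0).hom) ?_ ?_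
    ((LinearMap.range S.moduleCatToCycles).mkQ ∘ₗ c) ?_ ?_ hM
  · exact (ShortComplex.ShortExact.moduleCat_exact_iff_function_exact _).1 (P.exact_succ 0)
  · have h := (ShortComplex.ShortExact.moduleCat_exact_iff_function_exact _).1
      (ShortComplex.exact_of_g_is_cokernel
        (ShortComplex.mk _ _ P.complex_d_comp_π_f_zero) P.isColimitCokernelCofork)
    intro x
    refine Iff.trans ?_ (h x)
    exact (HomologicalComplex.singleObjXSelf (ComplexShape.down ℕ) 0
      (ModuleCat.of hahnRing M)).toLinearEquiv.map_eq_zero_iff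
  · refine (Submodule.mkQ_surjective _).comp ?_
    rintro ⟨x, hx⟩
    obtain ⟨z, rfl⟩ := exists_one_tmul_eq x
    exact ⟨⟨z, (one_tmul_eq_zero_iff _).1 ((hg z).symm.trans hx)⟩, rfl⟩
  · intro z hz
    obtain ⟨_, ⟨w, rfl⟩, v, hv, hwv⟩ := Submodule.mem_sup.1 hz
    rw [LinearMap.comp_apply, Submodule.mkQ_apply, Submodule.Quotient.mk_eq_zero]
    refine ⟨(1 : HahnResidue) ⊗ₜ[hahnRing] w, Subtype.ext ?_⟩
    refine (hf w).trans ?_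
    change _ = (1 : HahnResidue) ⊗ₜ[hahnRing] (z : P.complex.X 1)
    rw [← hwv, TensorProduct.tmul_add, (one_tmul_eq_zero_iff v).2 hv, add_zero]

end

theorem mainTheorem9 (M : Type*) [AddCommGroup M] [Module hahnRing M]
    (hM : IsThetaReflexive M) : Finite (hahnTor 1 HahnResidue M) := by
  exact finite_hahnTor_one M hM
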